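/- Let $K$ be a field of characteristic different from $2$. Let $M=\{m\in\mathbb{Z}^5:\sum m_i=0\}$ be the $A_4$ root lattice and let $\widetilde P$ be the smooth toric fourfold over $K$ whose fan consists of the $120$ Weyl chambers $\{\alpha\in\mathbb{R}^5:\sum\alpha_i=0,\ \alpha_{\varsigma(1)}\ge\alpha_{\varsigma(2)}\ge\dots\ge\alpha_{\varsigma(5)}\}$ ($\varsigma\in S_5$) and their faces. Its open torus is identified with $T=\mathbb{P}^4\setminus\{X_1X_2X_3X_4X_5=0\}$, the character $e_i-e_j\in M$ being $X_i/X_j$. For $\boldsymbol a=(a_1:\dots:a_6)\in\mathbb{P}^5$ let $X_{\boldsymbol a}\subset\widetilde P$ be the closure of the hypersurface $$(X_1+\dots+X_5)\left(\frac{a_1}{X_1}+\dots+\frac{a_5}{X_5}\right)=a_6$$ of $T$, and for $\boldsymbol b=(b_1:\dots:b_5)\in T$ put $$\phi(\boldsymbol b)=\bigl(b_1^2:\dots:b_5^2:(b_1+\dots+b_5)^2\bigr).$$ Let $\boldsymbol b\in T(K)$ with $b_1+\dots+b_5\neq0$. Then the number of nodes ($A_1$ singularities at $K$-points) of $X_{\phi(\boldsymbol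 b)}$ is exactly $$30+\#\Bigl\{J\subseteq\{1,2,3,4,5\}:\ \sum_{i\in J}b_i=0\Bigr\}$$ (the empty set $J=\emptyset$ is counted). Exactly $30$ of these nodes lie on the toric boundary $\widetilde P\setminus T$, and the nodes in $T$ correspond to sign changes of $\boldsymbol b$: the map sending $J$ to the point obtained from $(b_1:\dots:b_5)$ by changing the sign of $b_i$ for all $i\in J$ is a bijection from $\{J\subseteq\{1,\dots,5\}:\sum_{i\in J}b_i=0\}$ onto the set of nodes of $X_{\phi(\boldsymbol b)}$ in $T$. -/

import Mathlib

noncomputable section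

namespace A4Toric

/-- The root lattice `M` of type `A₄`: integer vectors of length five with sum zero.
It is the character lattice of the torus. -/
def rootLattice : AddSubgroup (Fin 5 → ℤ) where
  carrier := {m | ∑ i, m i = 0}
  zero_mem' := by simp
  add_mem' := by
    intro a b ha hb
    simp only [Set.mem_ofPred_eq, Pi.add_apply, Finset.sum_add_distrib] at *
    omega
  neg_mem' := by
    intro a ha
    simp only [Set.mem_ofPred_eq, Pi.neg_apply, Finset.sum_neg_distrib] at *
    omega

/-- The vector `e_i - e_j` of the root lattice; as a character of the torus it is `X_i / X_j`. -/
def root (i j : Fin 5) : rootLattice :=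
  ⟨Pi.single i 1 - Pi.single j 1, by
    change ∑ k, (Pi.single i (1 : ℤ) - Pi.single j 1 : Fin 5 → ℤ) k = 0
    simp [Finset.sum_sub_distrib]⟩

/-- The Weyl chamber `α_{ς 0} ≥ α_{ς 1} ≥ ⋯ ≥ α_{ς 4}` in `{α ∈ ℝ⁵ | ∑ α_i = 0}`.
The 120 chambers are the maximal cones of the fan. -/
def chamber (ς : Equiv.Perm (Fin 5)) : Set (Fin 5 → ℝ) :=
  {α | ∑ i, α i = 0 ∧ Antitone (α ∘ ς)}

/-- The monoid `C^∨ ∩ M` of lattice points of the dual cone of `C`. -/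
def dualMonoid (C : Set (Fin 5 → ℝ)) : AddSubmonoid rootLattice where
  carrier := {m | ∀ α ∈ C, 0 ≤ ∑ i, α i * ((m.1 i : ℤ) : ℝ)}
  zero_mem' := by
    intro α _
    simp
  add_mem' := by
    intro a b ha hb α hα
    have h1 := ha α hα
    have h2 := hb α hα
    simp only [AddSubgroup.coe_add, Pi.add_apply, Int.cast_add, mul_add, Finset.sum_add_distrib]
    exact add_nonneg h1 h2

/-- The basis vectors `e_{ς l} - e_{ς (l+1)}`, `l = 0, …, 3`, of the dual of the chamber of `ς`. -/
def simpleRoot (ς : Equiv.Perm (Fin 5)) (l : Fin 4) : rootLattice :=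
  root (ς l.castSucc) (ς l.succ)

theorem simpleRoot_mem (ς : Equiv.Perm (Fin 5)) (l : Fin 4) {C : Set (Fin 5 → ℝ)}
    (hC : C ⊆ chamber ς) : simpleRoot ς l ∈ dualMonoid C := by
  intro α hα
  have h : α (ς l.succ) ≤ α (ς l.castSucc) := (hC hα).2 (Fin.castSucc_lt_succ).le
  have e : ∑ i, α i * (((simpleRoot ς l).1 i : ℤ) : ℝ) = α (ς l.castSucc) - α (ς l.succ) := by
    simp [simpleRoot, root, mul_sub, Finset.sum_sub_distrib, Pi.single_apply]
  rw [e]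
  linarith

/-- The gluing of the affine charts. The chart of `ς` is the affine space with ring of functions
`K[(chamber ς)^∨ ∩ M]`, and its coordinates are the characters `simpleRoot ς l`. The charts of
`ς` and `τ` are glued along the affine toric variety of the cone `chamber ς ∩ chamber τ`, whose
`K`-points are the monoid homomorphisms from the dual monoid of that cone to `(K, ·)`: a point
`p` of the first chart is identified with a point `q` of the second if both are the image of
the same `K`-point `χ`. -/
def Glue (K : Type*) [Field K] (P Q : Equiv.Perm (Fin 5) × (Fin 4 → K)) : Prop :=
  ∃ χ : Multiplicative (dualMonoid (chamber P.1 ∩ chamber Q.1)) →* K,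
    (∀ l, χ (Multiplicative.ofAdd
      ⟨simpleRoot P.1 l, simpleRoot_mem P.1 l Set.inter_subset_left⟩) = P.2 l) ∧
    (∀ l, χ (Multiplicative.ofAdd
      ⟨simpleRoot Q.1 l, simpleRoot_mem Q.1 l Set.inter_subset_right⟩) = Q.2 l)

/-- The set of `K`-points of the smooth toric fourfold of the fan of Weyl chambers of type `A₄`. -/
def ToricVariety (K : Type*) [Field K] : Type _ := Quot (Glue K)

/-- The point with coordinates `p` in the affine chart of `ς`. -/
def chartPoint {K : Type*} [Field K] (ς : Equiv.Perm (Fin 5)) (p : Fin 4 → K) : ToricVariety K :=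
  Quot.mk _ (ς, p)

/-- The point `(c_0 : ⋯ : c_4)` of the torus (meant for nonzero `c_i`), as a point of the
toric variety. -/
def torusPoint {K : Type*} [Field K] (c : Fin 5 → K) : ToricVariety K :=
  chartPoint 1 fun l => c l.castSucc / c l.succ

/-- The open torus `T = ℙ⁴ ∖ {X_0 ⋯ X_4 = 0}`; the toric boundary is its complement. -/
def torus (K : Type*) [Field K] : Set (ToricVariety K) :=
  {P | ∃ c : Fin 5 → K, (∀ i, c i ≠ 0) ∧ P = torusPoint c}

/-- The Laurent polynomial `(∑ X_i) (∑ a_j / X_j) - a_5`, expanded in characters `X_i / X_j`. -/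
def equation {K : Type*} [Field K] (a : Fin 6 → K) : AddMonoidAlgebra K rootLattice :=
  ∑ i : Fin 5, ∑ j : Fin 5, AddMonoidAlgebra.single (root i j) (a j.castSucc)
    - AddMonoidAlgebra.single 0 (a (Fin.last 5))

/-- Restriction of regular functions from the chart of `ς` to the torus:
the coordinate `x_l` goes to the character `X_{ς l} / X_{ς (l+1)}`. -/
def restrictToTorus (K : Type*) [Field K] (ς : Equiv.Perm (Fin 5)) :
    MvPolynomial (Fin 4) K →ₐ[K] AddMonoidAlgebra K rootLattice :=
  MvPolynomial.aeval fun l => AddMonoidAlgebra.single (simpleRoot ς l) 1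

/-- The ideal, in the chart of `ς`, of `X_a`, the closure in the toric variety of the hypersurface
`(∑ X_i) (∑ a_j / X_j) = a_5` of the torus: all polynomials whose restriction to the torus
lies in the ideal of that hypersurface. -/
def chartIdeal {K : Type*} [Field K] (a : Fin 6 → K) (ς : Equiv.Perm (Fin 5)) :
    Ideal (MvPolynomial (Fin 4) K) :=
  (Ideal.span {equation a}).comap (restrictToTorus K ς)

/-- `p` is a node (`A₁` singularity, ordinary double point) of the hypersurface with ideal `I` in
affine `n`-space over a field of characteristic other than two: a generator of `I` vanishes at `p`
together with its first derivatives, and its Hessian matrix at `p` is nondegenerate. -/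
def IsAffineNode {K : Type*} [Field K] {n : ℕ} (I : Ideal (MvPolynomial (Fin n) K))
    (p : Fin n → K) : Prop :=
  ∃ F : MvPolynomial (Fin n) K, I = Ideal.span {F} ∧
    MvPolynomial.eval p F = 0 ∧
    (∀ i, MvPolynomial.eval p (MvPolynomial.pderiv i F) = 0) ∧
    (Matrix.of fun i j =>
      MvPolynomial.eval p (MvPolynomial.pderiv i (MvPolynomial.pderiv j F))).det ≠ 0

/-- The set of nodes of `X_a`, the closure in the toric variety of the hypersurface
`(∑ X_i) (∑ a_j / X_j) = a_5` of the torus. -/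
def nodes {K : Type*} [Field K] (a : Fin 6 → K) : Set (ToricVariety K) :=
  {P | ∃ (ς : Equiv.Perm (Fin 5)) (p : Fin 4 → K),
    P = chartPoint ς p ∧ IsAffineNode (chartIdeal a ς) p}

/-- `φ(b) = (b_0² : ⋯ : b_4² : (b_0 + ⋯ + b_4)²)`. -/
def phi {K : Type*} [Field K] (b : Fin 5 → K) : Fin 6 → K :=
  Fin.snoc (fun i => b i ^ 2) ((∑ i, b i) ^ 2)

/-- Change the signs of the coordinates `b_i`, `i ∈ J`. -/
def signChange {K : Type*} [Field K] (b : Fin 5 → K) (J : Finset (Fin 5)) : Fin 5 → K :=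
  fun i => if i ∈ J then -b i else b i

end A4Toric

end

/-! In the chart of `ς`, with coordinates x, y, z, w, the equation times the unit X_{ς 0}/X_{ς 4} is
the polynomial F = A·B - s·xyzw, where A = ∑ X_i/X_{ς 4} and B = ∑ a_j X_{ς 0}/X_j. Its constant
term is nonzero, so no coordinate divides F and F generates the ideal of the closure
(`chartIdeal_eq_span`). What remains is a local computation followed by a count.

On the torus the logarithmic derivatives of F make X_i² proportional to b_i². A singular point is
therefore, after scaling, a vector c with c_i = ±b_i. The equation gives (∑ c_i)² = (∑ b_i)², and
the remaining overall sign is used to get ∑ c_i = ∑ b_i, which says that the flipped b_i sum to zero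
(`exists_signs_of_isSingularZero`). The logarithmic Hessian there is a multiple of a Brownian bridge
covariance matrix, whose determinant factors (`det_bridge`).

On the boundary each chart has exactly one singular point, and it is a node
(`eq_of_isSingularZero_of_eq_zero`, `det_chartHessian_boundary`). It depends only on the ordered
partition {ς 0, ς 1}, {ς 2}, {ς 3, ς 4} (`boundaryNode_eq_iff`), and there are 5!/(2!·2!) = 30 of
these. Points of different charts are identified by exhibiting a gluing homomorphism
(`chartPoint_orbitPoint_eq`) and separated by the values of X_i/X_j in K ∪ {∞} (`ratio`). -/

noncomputable section

namespace A4Toric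


/-! ### Roots and characters. -/

section Lattice

theorem root_val (i j : Fin 5) : (root i j).1 = Pi.single i 1 - Pi.single j 1 := rfl

theorem root_add_root (i j k : Fin 5) : root i j + root j k = root i k :=
  Subtype.ext (by simp [root_val])

theorem root_self (i : Fin 5) : root i i = 0 := Subtype.ext (by simp [root_val])

/-- The value of the character `m` at the point `c` of the torus. -/
def character {K : Type*} [Field K] (c : Fin 5 → K) (m : rootLattice) : K := ∏ i, c i ^ m.1 i

theorem character_zero {K : Type*} [Field K] (c : Fin 5 → K) : character c 0 = 1 := by
  simp [character]

theorem character_add {K : Type*} [Field K] {c : Fin 5 → K} (hc : ∀ i, c i ≠ 0)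
    (m n : rootLattice) : character c (m + n) = character c m * character c n := by
  simp [character, zpow_add₀ (hc _), Finset.prod_mul_distrib]

theorem character_root {K : Type*} [Field K] {c : Fin 5 → K} (hc : ∀ i, c i ≠ 0) (i j : Fin 5) :
    character c (root i j) = c i / c j := by
  have h (i : Fin 5) : ∏ k, c k ^ (Pi.single i (1 : ℤ) : Fin 5 → ℤ) k = c i := by
    rw [Finset.prod_eq_single i] <;> simp +contextual
  simp only [character, root_val, Pi.sub_apply, zpow_sub₀ (hc _), Finset.prod_div_distrib, h]

theorem pairing_root (α : Fin 5 → ℝ) (i j : Fin 5) :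
    ∑ k, α k * (((root i j).1 k : ℤ) : ℝ) = α i - α j := by
  simp [root_val, mul_sub, Finset.sum_sub_distrib, Pi.single_apply]

theorem root_mem_dualMonoid {ς : Equiv.Perm (Fin 5)} {C : Set (Fin 5 → ℝ)} (hC : C ⊆ chamber ς)
    {i j : Fin 5} (hij : ς.symm i ≤ ς.symm j) : root i j ∈ dualMonoid C := by
  intro α hα
  have h := (hC hα).2 hij
  simp only [Function.comp_apply, Equiv.apply_symm_apply] at h
  rw [pairing_root]
  linarith

theorem sum_interval_sub {G : Type*} [AddCommGroup G] (f : Fin 5 → G) {k l : Fin 5} (h : k ≤ l) :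
    ∑ m : Fin 4 with k ≤ m.castSucc ∧ m.castSucc < l, (f m.castSucc - f m.succ) = f k - f l := by
  rw [Finset.sum_filter, Fin.sum_univ_four]
  revert h
  fin_cases k <;> fin_cases l <;> intro h <;>
    first | exact absurd h (by decide) | simp [Fin.le_def, Fin.lt_def]

theorem sum_interval_simpleRoot (ς : Equiv.Perm (Fin 5)) {k l : Fin 5} (h : k ≤ l) :
    ∑ m : Fin 4 with k ≤ m.castSucc ∧ m.castSucc < l, simpleRoot ς m = root (ς k) (ς l) := by
  apply Subtype.ext
  rw [AddSubgroup.val_finsetSum]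
  exact sum_interval_sub (fun i => (Pi.single (ς i) 1 : Fin 5 → ℤ)) h

end Lattice

/-! ### The functions X_i/X_j, which separate points of the quotient. -/

section Ratio

variable {K : Type*} [Field K]

/-- The product of the coordinates `p_m`, `k ≤ m < l`. -/
def intervalProd (p : Fin 4 → K) (k l : Fin 5) : K :=
  ∏ m : Fin 4 with k ≤ m.castSucc ∧ m.castSucc < l, p m

theorem intervalProd_succ (p : Fin 4 → K) (l : Fin 4) :
    intervalProd p l.castSucc l.succ = p l := by
  have : (Finset.univ.filter fun m : Fin 4 => l.castSucc ≤ m.castSucc ∧ m.castSucc < l.succ)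
      = {l} := by
    ext m
    simp only [Finset.mem_filter, Finset.mem_univ, true_and, Finset.mem_singleton, Fin.le_def,
      Fin.lt_def, Fin.ext_iff, Fin.val_castSucc, Fin.val_succ]
    omega
  rw [intervalProd, this, Finset.prod_singleton]

/-- The value of the rational function `X_i / X_j` at a point of a chart; `none` stands for
infinity. -/
def chartRatio (P : Equiv.Perm (Fin 5) × (Fin 4 → K)) (i j : Fin 5) : Option K :=
  open Classical in
  if P.1.symm i ≤ P.1.symm j then some (intervalProd P.2 (P.1.symm i) (P.1.symm j))
  else if intervalProd P.2 (P.1.symm j) (P.1.symm i) = 0 then none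
  else some (intervalProd P.2 (P.1.symm j) (P.1.symm i))⁻¹

theorem hom_root_eq {ς : Equiv.Perm (Fin 5)} {p : Fin 4 → K} {C : Set (Fin 5 → ℝ)}
    (hC : C ⊆ chamber ς) (χ : Multiplicative (dualMonoid C) →* K)
    (hχ : ∀ l, χ (Multiplicative.ofAdd ⟨simpleRoot ς l, simpleRoot_mem ς l hC⟩) = p l)
    {i j : Fin 5} (hij : ς.symm i ≤ ς.symm j) :
    χ (Multiplicative.ofAdd ⟨root i j, root_mem_dualMonoid hC hij⟩)
      = intervalProd p (ς.symm i) (ς.symm j) := by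
  have e : (⟨root i j, root_mem_dualMonoid hC hij⟩ : dualMonoid C) =
      ∑ m : Fin 4 with ς.symm i ≤ m.castSucc ∧ m.castSucc < ς.symm j,
        ⟨simpleRoot ς m, simpleRoot_mem ς m hC⟩ := by
    apply Subtype.ext
    rw [AddSubmonoid.coe_finsetSum]
    simpa using (sum_interval_simpleRoot ς hij).symm
  rw [e, ofAdd_sum, map_prod, intervalProd]
  exact Finset.prod_congr rfl fun m _ => hχ m

theorem hom_root_mul {C : Set (Fin 5 → ℝ)} (χ : Multiplicative (dualMonoid C) →* K) {i j : Fin 5}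
    (h : root i j ∈ dualMonoid C) (h' : root j i ∈ dualMonoid C) :
    χ (Multiplicative.ofAdd ⟨root i j, h⟩) * χ (Multiplicative.ofAdd ⟨root j i, h'⟩) = 1 := by
  rw [← map_mul, ← ofAdd_add]
  have : (⟨root i j, h⟩ + ⟨root j i, h'⟩ : dualMonoid C) = 0 :=
    Subtype.ext (by simp [root_add_root, root_self])
  rw [this, ofAdd_zero, map_one]

/-- If the two charts order i and j oppositely, both X_i/X_j and X_j/X_i are regular on the overlap,
so their values are mutually inverse and infinity cannot occur. Invariance under `Glue` suffices to
descend to the quotient; transitivity of `Glue` is never needed. -/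
theorem chartRatio_eq_of_glue {P Q : Equiv.Perm (Fin 5) × (Fin 4 → K)} (h : Glue K P Q)
    (i j : Fin 5) : chartRatio P i j = chartRatio Q i j := by
  obtain ⟨χ, hP, hQ⟩ := h
  have eP {i j} (hij) := hom_root_eq (p := P.2) Set.inter_subset_left χ hP (i := i) (j := j) hij
  have eQ {i j} (hij) := hom_root_eq (p := Q.2) Set.inter_subset_right χ hQ (i := i) (j := j) hij
  unfold chartRatio
  rcases le_or_gt (P.1.symm i) (P.1.symm j) with h1 | h1 <;>
    rcases le_or_gt (Q.1.symm i) (Q.1.symm j) with h2 | h2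
  · rw [if_pos h1, if_pos h2, ← eP h1, ← eQ h2]
  · have h := hom_root_mul χ (root_mem_dualMonoid Set.inter_subset_left h1)
      (root_mem_dualMonoid Set.inter_subset_right h2.le)
    rw [eP h1, eQ h2.le] at h
    rw [if_pos h1, if_neg h2.not_ge, if_neg (right_ne_zero_of_mul_eq_one h),
      eq_inv_of_mul_eq_one_left h]
  · have h := hom_root_mul χ (root_mem_dualMonoid Set.inter_subset_right h2)
      (root_mem_dualMonoid Set.inter_subset_left h1.le)
    rw [eP h1.le, eQ h2] at h
    rw [if_pos h2, if_neg h1.not_ge, if_neg (right_ne_zero_of_mul_eq_one h),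
      eq_inv_of_mul_eq_one_left h]
  · rw [if_neg h1.not_ge, if_neg h2.not_ge, ← eP h1.le, ← eQ h2.le]

/-- The value of the rational function `X_i / X_j` at a point of the toric variety; `none` stands
for infinity. -/
def ratio (P : ToricVariety K) (i j : Fin 5) : Option K :=
  Quot.lift (fun P => chartRatio P i j) (fun _ _ h => chartRatio_eq_of_glue h i j) P

theorem ratio_chartPoint_of_le {ς : Equiv.Perm (Fin 5)} (p : Fin 4 → K) {k l : Fin 5}
    (h : k ≤ l) : ratio (chartPoint ς p) (ς k) (ς l) = some (intervalProd p k l) := by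
  simp [ratio, chartPoint, chartRatio, h]

theorem ratio_chartPoint_succ (ς : Equiv.Perm (Fin 5)) (p : Fin 4 → K) (l : Fin 4) :
    ratio (chartPoint ς p) (ς l.castSucc) (ς l.succ) = some (p l) := by
  rw [ratio_chartPoint_of_le p Fin.castSucc_lt_succ.le, intervalProd_succ]

theorem ratio_chartPoint_eq_zero_iff (ς : Equiv.Perm (Fin 5)) (p : Fin 4 → K) (i j : Fin 5) :
    ratio (chartPoint ς p) i j = some 0 ↔
      ς.symm i ≤ ς.symm j ∧ intervalProd p (ς.symm i) (ς.symm j) = 0 := by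
  change chartRatio (ς, p) i j = some 0 ↔ _
  unfold chartRatio
  split_ifs with h1 h2 <;> simp_all

end Ratio

/-! ### Identifying points of different charts along torus orbits. -/

section Gluing

variable {K : Type*} [Field K]

/-- The pairing of `m` with the fundamental coweight of a chamber. -/
def coweight (ς : Equiv.Perm (Fin 5)) (l : Fin 4) (m : rootLattice) : ℤ :=
  ∑ i, if ς.symm i ≤ l.castSucc then m.1 i else 0

theorem coweight_add (ς : Equiv.Perm (Fin 5)) (l : Fin 4) (m n : rootLattice) :
    coweight ς l (m + n) = coweight ς l m + coweight ς l n := by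
  simp only [coweight, ← Finset.sum_add_distrib]
  refine Finset.sum_congr rfl fun i _ => ?_
  split_ifs <;> simp

theorem coweight_zero (ς : Equiv.Perm (Fin 5)) (l : Fin 4) : coweight ς l 0 = 0 := by
  simp [coweight]

theorem coweight_root (ς : Equiv.Perm (Fin 5)) (l : Fin 4) (i j : Fin 5) :
    coweight ς l (root i j) = (if ς.symm i ≤ l.castSucc then 1 else 0)
      - (if ς.symm j ≤ l.castSucc then 1 else 0) := by
  have h (j : Fin 5) : ∑ i, (if ς.symm i ≤ l.castSucc then (Pi.single j 1 : Fin 5 → ℤ) i else 0) =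
      if ς.symm j ≤ l.castSucc then 1 else 0 := by
    rw [Finset.sum_eq_single j] <;> simp +contextual
  rw [← h i, ← h j, ← Finset.sum_sub_distrib, coweight]
  refine Finset.sum_congr rfl fun k _ => ?_
  split_ifs <;> simp [root_val]

/-- The hypothesis says that `ς` and `τ` have the same first l + 1 indices, so the fundamental
coweight spans a ray common to both chambers. -/
theorem coweight_nonneg {ς τ : Equiv.Perm (Fin 5)} {l : Fin 4}
    (h : ∀ k, ς.symm (τ k) ≤ l.castSucc ↔ k ≤ l.castSucc) {m : rootLattice}
    (hm : m ∈ dualMonoid (chamber ς ∩ chamber τ)) : 0 ≤ coweight ς l m := by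
  -- Five times the fundamental coweight, shifted to have coordinate sum zero; the shift pairs to
  -- zero with the root lattice.
  set α : Fin 5 → ℝ := fun i => 5 * (if ς.symm i ≤ l.castSucc then 1 else 0) - (l.1 + 1)
  have anti : Antitone fun k : Fin 5 =>
      (5 * (if k ≤ l.castSucc then 1 else 0) - (l.1 + 1) : ℝ) := by
    intro a b hab
    dsimp only
    by_cases hb : b ≤ l.castSucc
    · simp [hb, hab.trans hb]
    · simp only [hb, if_false]
      split_ifs <;> linarith
  have hsum : ∑ i, α i = 0 := by
    rw [← Equiv.sum_comp ς]
    simp only [α, Equiv.symm_apply_apply]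
    fin_cases l <;> simp [Fin.sum_univ_five, Fin.le_def] <;> norm_num
  have hα : α ∈ chamber ς ∩ chamber τ := by
    refine ⟨⟨hsum, ?_⟩, ⟨hsum, ?_⟩⟩
    · convert anti using 2
      simp [α]
    · convert anti using 2 with k
      simp only [α, Function.comp_apply, h k]
  have hs : ∑ i, ((m.1 i : ℤ) : ℝ) = 0 := by exact_mod_cast m.2
  have key : ∑ i, α i * ((m.1 i : ℤ) : ℝ) = 5 * (coweight ς l m : ℝ) := by
    simp only [α, sub_mul, Finset.sum_sub_distrib, ← Finset.mul_sum, hs, mul_zero, sub_zero,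
      mul_assoc, coweight, Int.cast_sum]
    congr 1
    refine Finset.sum_congr rfl fun i _ => ?_
    split_ifs <;> simp
  have := hm α hα
  rw [key] at this
  have h0 : (0 : ℝ) ≤ coweight ς l m := by linarith
  exact_mod_cast h0

/-- The point of the chart of `ς` in the torus orbit where the coordinates in `Z` vanish, whose
other coordinates are those of the point `c` of the torus. -/
def orbitPoint (ς : Equiv.Perm (Fin 5)) (Z : Finset (Fin 4)) (c : Fin 5 → K) : Fin 4 → K :=
  fun l => if l ∈ Z then 0 else c (ς l.castSucc) / c (ς l.succ)

theorem chartPoint_orbitPoint_eq {ς τ : Equiv.Perm (Fin 5)} {Z : Finset (Fin 4)}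
    (hZ : ∀ l ∈ Z, ∀ k, ς.symm (τ k) ≤ l.castSucc ↔ k ≤ l.castSucc)
    {c : Fin 5 → K} (hc : ∀ i, c i ≠ 0) :
    chartPoint ς (orbitPoint ς Z c) = chartPoint τ (orbitPoint τ Z c) := by
  classical
  apply Quot.sound
  -- The point of the orbit: the character of `c` on the face where the coweights in `Z` vanish, and
  -- zero off it. It is multiplicative because nonnegative coweights add up to zero only if both are
  -- zero.
  let χ : Multiplicative (dualMonoid (chamber ς ∩ chamber τ)) →* K :=
    { toFun := fun m => if ∀ l ∈ Z, coweight ς l m.toAdd.1 = 0 then character c m.toAdd.1 else 0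
      map_one' := by simp [coweight_zero, character_zero]
      map_mul' := by
        intro m n
        have hm (l) (hl : l ∈ Z) := coweight_nonneg (hZ l hl) m.toAdd.2
        have hn (l) (hl : l ∈ Z) := coweight_nonneg (hZ l hl) n.toAdd.2
        have : (∀ l ∈ Z, coweight ς l (m * n).toAdd.1 = 0) ↔
            (∀ l ∈ Z, coweight ς l m.toAdd.1 = 0) ∧ (∀ l ∈ Z, coweight ς l n.toAdd.1 = 0) := by
          simp only [toAdd_mul, AddSubmonoid.coe_add, coweight_add]
          constructor
          · intro h
            refine ⟨fun l hl => ?_, fun l hl => ?_⟩ <;>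
              linarith [hm l hl, hn l hl, h l hl]
          · rintro ⟨h1, h2⟩ l hl
            rw [h1 l hl, h2 l hl, add_zero]
        simp only [toAdd_mul, AddSubmonoid.coe_add, character_add hc]
        split_ifs <;> simp_all }
  have key (σ : Equiv.Perm (Fin 5)) (hσ : ∀ l ∈ Z, ∀ k, ς.symm (σ k) ≤ l.castSucc ↔ k ≤ l.castSucc)
      (k : Fin 4) (h : simpleRoot σ k ∈ dualMonoid (chamber ς ∩ chamber τ)) :
      χ (Multiplicative.ofAdd ⟨simpleRoot σ k, h⟩) = orbitPoint σ Z c k := by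
    have : (∀ l ∈ Z, coweight ς l (simpleRoot σ k) = 0) ↔ k ∉ Z := by
      have e (l) (hl : l ∈ Z) : coweight ς l (simpleRoot σ k) = 0 ↔ l ≠ k := by
        simp only [simpleRoot, coweight_root, hσ l hl, Fin.le_def, Fin.val_castSucc, Fin.val_succ,
          ne_eq, Fin.ext_iff]
        split_ifs <;> omega
      exact ⟨fun h hk => (e k hk).1 (h k hk) rfl, fun h l hl => (e l hl).2 fun hlk => h (hlk ▸ hl)⟩
    change (if ∀ l ∈ Z, coweight ς l (simpleRoot σ k) = 0 then character c (simpleRoot σ k) else 0)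
      = _
    simp only [this, orbitPoint, ite_not]
    rw [simpleRoot, character_root hc]
  exact ⟨χ, fun l => key ς (by simp) l _, fun l => key τ hZ l _⟩

theorem torusPoint_eq_chartPoint (ς : Equiv.Perm (Fin 5)) {c : Fin 5 → K} (hc : ∀ i, c i ≠ 0) :
    torusPoint c = chartPoint ς fun l => c (ς l.castSucc) / c (ς l.succ) := by
  have h (σ : Equiv.Perm (Fin 5)) :
      orbitPoint σ ∅ c = fun l => c (σ l.castSucc) / c (σ l.succ) := by
    funext l
    simp [orbitPoint]
  rw [← h, ← chartPoint_orbitPoint_eq (ς := 1) (by simp) hc, h]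
  rfl

theorem ratio_torusPoint {c : Fin 5 → K} (hc : ∀ i, c i ≠ 0) {i j : Fin 5} (hij : i ≠ j) :
    ratio (torusPoint c) i j = some (c i / c j) := by
  obtain ⟨ς, h0, h1⟩ : ∃ ς : Equiv.Perm (Fin 5), ς 0 = i ∧ ς 1 = j := by
    revert i j; decide +kernel
  rw [torusPoint_eq_chartPoint ς hc]
  have := ratio_chartPoint_succ ς (fun l => c (ς l.castSucc) / c (ς l.succ)) 0
  simpa [h0, h1] using this

theorem chartPoint_mem_torus_iff (ς : Equiv.Perm (Fin 5)) (p : Fin 4 → K) :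
    chartPoint ς p ∈ torus K ↔ ∀ l, p l ≠ 0 := by
  constructor
  · rintro ⟨c, hc, h⟩ l
    have h1 := ratio_chartPoint_succ ς p l
    rw [h, ratio_torusPoint hc (ς.injective.ne Fin.castSucc_lt_succ.ne), Option.some_inj] at h1
    rw [← h1]
    exact div_ne_zero (hc _) (hc _)
  · intro hp
    -- Homogeneous coordinates with the last one normalised to 1, recovered from their successive
    -- ratios.
    let d : Fin 5 → K := ![p 0 * p 1 * p 2 * p 3, p 1 * p 2 * p 3, p 2 * p 3, p 3, 1]
    have hd : ∀ i, d i ≠ 0 := by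
      intro i
      fin_cases i <;> simp [d, hp]
    refine ⟨d ∘ ς.symm, fun i => hd _, ?_⟩
    rw [torusPoint_eq_chartPoint ς (c := d ∘ ς.symm) fun i => hd _]
    congr 1
    have := hp 0; have := hp 1; have := hp 2; have := hp 3
    funext l
    fin_cases l <;> simp [d] <;> field_simp

end Gluing


/-! ### The equation of the closure in a chart. -/

open MvPolynomial

variable {K : Type*} [Field K]

/-- The factor `∑ X_i / X_4` in the coordinates of the chart. -/
def sumFactor (K : Type*) [Field K] : MvPolynomial (Fin 4) K :=
  1 + X 3 + X 2 * X 3 + X 1 * X 2 * X 3 + X 0 * X 1 * X 2 * X 3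

/-- The factor `∑ a_j X_0 / X_j` in the coordinates of the chart. -/
def inverseFactor (a : Fin 5 → K) : MvPolynomial (Fin 4) K :=
  C (a 0) + C (a 1) * X 0 + C (a 2) * (X 0 * X 1) + C (a 3) * (X 0 * X 1 * X 2)
    + C (a 4) * (X 0 * X 1 * X 2 * X 3)

/-- The equation of the hypersurface in the coordinates of the chart. -/
def chartPoly (a : Fin 5 → K) (s : K) : MvPolynomial (Fin 4) K :=
  sumFactor K * inverseFactor a - C s * (X 0 * X 1 * X 2 * X 3)

theorem restrictToTorus_sumFactor (ς : Equiv.Perm (Fin 5)) :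
    restrictToTorus K ς (sumFactor K) = ∑ i, AddMonoidAlgebra.single (root (ς i) (ς 4)) 1 := by
  simp [restrictToTorus, sumFactor, Fin.sum_univ_five, simpleRoot, root_add_root, root_self,
    AddMonoidAlgebra.single_mul_single]
  rw [AddMonoidAlgebra.one_def]
  abel

theorem restrictToTorus_inverseFactor (ς : Equiv.Perm (Fin 5)) (a : Fin 5 → K) :
    restrictToTorus K ς (inverseFactor a) =
      ∑ j, AddMonoidAlgebra.single (root (ς 0) (ς j)) (a j) := by
  simp [restrictToTorus, inverseFactor, Fin.sum_univ_five, simpleRoot, root_add_root, root_self,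
    AddMonoidAlgebra.single_mul_single, ← algebraMap_eq]

theorem restrictToTorus_chartPoly (ς : Equiv.Perm (Fin 5)) (a : Fin 6 → K) :
    restrictToTorus K ς (chartPoly (fun i => a (ς i).castSucc) (a (Fin.last 5))) =
      AddMonoidAlgebra.single (root (ς 0) (ς 4)) 1 * equation a := by
  have e : equation a = ∑ i : Fin 5, ∑ j : Fin 5,
      AddMonoidAlgebra.single (root (ς i) (ς j)) (a (ς j).castSucc)
        - AddMonoidAlgebra.single 0 (a (Fin.last 5)) := by
    rw [equation, ← Equiv.sum_comp ς]
    congr 1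
    refine Finset.sum_congr rfl fun i _ => ?_
    rw [← Equiv.sum_comp ς]
  have e2 (i j : Fin 5) : root (ς 0) (ς 4) + root (ς i) (ς j)
      = root (ς i) (ς 4) + root (ς 0) (ς j) := Subtype.ext (by simp [root_val]; abel)
  rw [e, chartPoly, map_sub, map_mul, restrictToTorus_sumFactor, restrictToTorus_inverseFactor,
    mul_sub, Finset.sum_mul_sum, Finset.mul_sum]
  congr 1
  · refine Finset.sum_congr rfl fun i _ => ?_
    rw [Finset.mul_sum]
    simp [AddMonoidAlgebra.single_mul_single, e2]
  · simp [restrictToTorus, simpleRoot, root_add_root, AddMonoidAlgebra.single_mul_single,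
      ← algebraMap_eq]

theorem isUnit_single_root (i j : Fin 5) :
    IsUnit (AddMonoidAlgebra.single (root i j) 1 : AddMonoidAlgebra K rootLattice) := by
  refine IsUnit.of_mul_eq_one (AddMonoidAlgebra.single (root j i) 1) ?_
  simp [AddMonoidAlgebra.single_mul_single, root_add_root, root_self, AddMonoidAlgebra.one_def]

theorem coweight_simpleRoot (ς : Equiv.Perm (Fin 5)) (l k : Fin 4) :
    coweight ς l (simpleRoot ς k) = if k = l then 1 else 0 := by
  simp only [simpleRoot, coweight_root, Equiv.symm_apply_apply, Fin.le_def, Fin.val_castSucc,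
    Fin.val_succ, Fin.ext_iff]
  split_ifs <;> omega

/-- The embedding of the coordinate ring of the torus into the field of rational functions. -/
def toRational (K : Type*) [Field K] (ς : Equiv.Perm (Fin 5)) :
    AddMonoidAlgebra K rootLattice →ₐ[K] FractionRing (MvPolynomial (Fin 4) K) :=
  AddMonoidAlgebra.lift K _ _
    { toFun := fun m => ∏ l, algebraMap (MvPolynomial (Fin 4) K) _ (X l) ^ coweight ς l m.toAdd
      map_one' := by simp [coweight_zero]
      map_mul' := by
        intro m n
        rw [← Finset.prod_mul_distrib]
        refine Finset.prod_congr rfl fun l _ => ?_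
        rw [toAdd_mul, coweight_add, zpow_add₀]
        simp [X_ne_zero] }

theorem toRational_single (ς : Equiv.Perm (Fin 5)) (m : rootLattice) (r : K) :
    toRational K ς (AddMonoidAlgebra.single m r) =
      r • ∏ l, algebraMap (MvPolynomial (Fin 4) K) _ (X l) ^ coweight ς l m := by
  rw [toRational, AddMonoidAlgebra.lift_single]
  rfl

/-- This lets divisibility in the coordinate ring of the torus be tested in the field of fractions
of the chart. -/
theorem toRational_restrictToTorus (ς : Equiv.Perm (Fin 5)) (g : MvPolynomial (Fin 4) K) :
    toRational K ς (restrictToTorus K ς g) = algebraMap _ _ g := by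
  have : (toRational K ς).comp (restrictToTorus K ς) =
      IsScalarTower.toAlgHom K (MvPolynomial (Fin 4) K) _ := by
    apply MvPolynomial.algHom_ext
    intro l
    simp only [AlgHom.comp_apply, restrictToTorus, aeval_X, toRational_single, one_smul,
      coweight_simpleRoot, IsScalarTower.coe_toAlgHom']
    rw [Finset.prod_eq_single l] <;> simp +contextual [eq_comm]
  exact DFunLike.congr_fun this g

theorem exists_pow_mul_toRational (ς : Equiv.Perm (Fin 5)) (h : AddMonoidAlgebra K rootLattice) :
    ∃ (n : ℕ) (g : MvPolynomial (Fin 4) K),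
      algebraMap (MvPolynomial (Fin 4) K) _ ((∏ l, X l) ^ n) * toRational K ς h = algebraMap _ _ g := by
  induction h using AddMonoidAlgebra.induction_linear with
  | zero => exact ⟨0, 0, by simp⟩
  | add x y hx hy =>
    obtain ⟨n, g, hg⟩ := hx
    obtain ⟨n', g', hg'⟩ := hy
    refine ⟨n + n', (∏ l, X l) ^ n' * g + (∏ l, X l) ^ n * g', ?_⟩
    rw [map_add, map_add, map_mul, map_mul, ← hg, ← hg', pow_add, map_mul]
    ring
  | single m r =>
    let n : ℕ := ∑ l, (coweight ς l m).natAbs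
    have hn (l : Fin 4) : 0 ≤ (n : ℤ) + coweight ς l m := by
      have : (coweight ς l m).natAbs ≤ n :=
        Finset.single_le_sum (f := fun l => (coweight ς l m).natAbs) (by simp) (Finset.mem_univ l)
      omega
    refine ⟨n, C r * ∏ l, X l ^ ((n : ℤ) + coweight ς l m).toNat, ?_⟩
    rw [toRational_single, ← algebraMap_eq, map_mul, ← IsScalarTower.algebraMap_apply,
      Algebra.smul_def, map_pow, map_prod, map_prod, ← Finset.prod_pow, mul_left_comm,
      ← Finset.prod_mul_distrib]
    congr 1
    refine Finset.prod_congr rfl fun l _ => ?_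
    rw [map_pow, ← zpow_natCast _ (Int.toNat _), Int.toNat_of_nonneg (hn l), zpow_add₀,
      zpow_natCast]
    simp [X_ne_zero]

theorem isRelPrime_prod_X_pow {F : MvPolynomial (Fin 4) K} (hF : eval 0 F ≠ 0) (n : ℕ) :
    IsRelPrime ((∏ l : Fin 4, X l) ^ n) F := by
  refine IsRelPrime.pow_left (IsRelPrime.prod_left fun l _ => ?_)
  refine (Irreducible.isRelPrime_iff_not_dvd (X_prime).irreducible).2 ?_
  rintro ⟨g, rfl⟩
  simp at hF

/-- Passing to the torus inverts the coordinates. A polynomial with nonzero constant term is prime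
to each of them, so the monomial denominators can be cancelled. -/
theorem comap_span_eq {ς : Equiv.Perm (Fin 5)} {F : MvPolynomial (Fin 4) K} (hF : eval 0 F ≠ 0) :
    (Ideal.span {restrictToTorus K ς F}).comap (restrictToTorus K ς) = Ideal.span {F} := by
  ext g
  rw [Ideal.mem_comap, Ideal.mem_span_singleton, Ideal.mem_span_singleton]
  refine ⟨?_, fun h => map_dvd _ h⟩
  rintro ⟨h, hh⟩
  obtain ⟨n, q, hq⟩ := exists_pow_mul_toRational ς h
  have e := congrArg (toRational K ς) hh
  rw [map_mul, toRational_restrictToTorus, toRational_restrictToTorus] at e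
  have e2 : (∏ l, X l) ^ n * g = F * q := by
    apply IsFractionRing.injective (MvPolynomial (Fin 4) K) (FractionRing (MvPolynomial (Fin 4) K))
    rw [map_mul, map_mul, e, ← hq]
    ring
  exact (isRelPrime_prod_X_pow hF n).symm.dvd_of_dvd_mul_left ⟨q, e2⟩

theorem chartIdeal_eq_span {a : Fin 6 → K} {ς : Equiv.Perm (Fin 5)} (ha : a (ς 0).castSucc ≠ 0) :
    chartIdeal a ς =
      Ideal.span {chartPoly (fun i => a (ς i).castSucc) (a (Fin.last 5))} := by
  rw [← comap_span_eq (ς := ς), restrictToTorus_chartPoly,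
    Ideal.span_singleton_mul_left_unit (isUnit_single_root _ _), chartIdeal]
  simpa [chartPoly, sumFactor, inverseFactor] using ha


/-! ### Singular points in a chart. -/

/-- The polynomial and its first derivatives vanish at the point. -/
def IsSingularZero {n : ℕ} (F : MvPolynomial (Fin n) K) (p : Fin n → K) : Prop :=
  eval p F = 0 ∧ ∀ i, eval p (pderiv i F) = 0

/-- Any generator divides any other, and by the Leibniz rule a multiple of a singular equation is
singular. Hence the generator chosen in `IsAffineNode` is immaterial. -/
theorem IsAffineNode.isSingularZero {n : ℕ} {F : MvPolynomial (Fin n) K} {p : Fin n → K}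
    (h : IsAffineNode (Ideal.span {F}) p) : IsSingularZero F p := by
  obtain ⟨G, hG, h0, h1, -⟩ := h
  obtain ⟨q, rfl⟩ : G ∣ F := by
    rw [← Ideal.mem_span_singleton, ← hG]
    exact Ideal.mem_span_singleton_self F
  refine ⟨by simp [h0], fun i => by simp [Derivation.leibniz, h0, h1]⟩

theorem isAffineNode_span {n : ℕ} {F : MvPolynomial (Fin n) K} {p : Fin n → K}
    (h : IsSingularZero F p)
    (hdet : (Matrix.of fun i j => eval p (pderiv i (pderiv j F))).det ≠ 0) :
    IsAffineNode (Ideal.span {F}) p := ⟨F, rfl, h.1, h.2, hdet⟩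

theorem isSingularZero_chartPoly_iff (a : Fin 5 → K) (s x y z w : K) :
    IsSingularZero (chartPoly a s) ![x, y, z, w] ↔
      (1 + w + z * w + y * z * w + x * y * z * w) *
        (a 0 + a 1 * x + a 2 * (x * y) + a 3 * (x * y * z) + a 4 * (x * y * z * w))
          = s * (x * y * z * w) ∧
      y * z * w * (a 0 + a 1 * x + a 2 * (x * y) + a 3 * (x * y * z) + a 4 * (x * y * z * w)) +
        (1 + w + z * w + y * z * w + x * y * z * w) *
          (a 1 + a 2 * y + a 3 * (y * z) + a 4 * (y * z * w)) = s * (y * z * w) ∧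
      (z * w + x * z * w) *
          (a 0 + a 1 * x + a 2 * (x * y) + a 3 * (x * y * z) + a 4 * (x * y * z * w)) +
        (1 + w + z * w + y * z * w + x * y * z * w) *
          (a 2 * x + a 3 * (x * z) + a 4 * (x * z * w)) = s * (x * z * w) ∧
      (w + y * w + x * y * w) *
          (a 0 + a 1 * x + a 2 * (x * y) + a 3 * (x * y * z) + a 4 * (x * y * z * w)) +
        (1 + w + z * w + y * z * w + x * y * z * w) *
          (a 3 * (x * y) + a 4 * (x * y * w)) = s * (x * y * w) ∧
      (1 + z + y * z + x * y * z) *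
          (a 0 + a 1 * x + a 2 * (x * y) + a 3 * (x * y * z) + a 4 * (x * y * z * w)) +
        (1 + w + z * w + y * z * w + x * y * z * w) * (a 4 * (x * y * z)) = s * (x * y * z) := by
  simp only [IsSingularZero, Fin.forall_fin_succ, IsEmpty.forall_iff, and_true]
  simp [chartPoly, sumFactor, inverseFactor, Derivation.leibniz, pderiv_X]
  refine and_congr ?_ (and_congr ?_ (and_congr ?_ (and_congr ?_ ?_))) <;>
    constructor <;> intro h <;> linear_combination h

theorem exists_signs_of_isSingularZero {b : Fin 5 → K} (hs : ∑ i, b i ≠ 0)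
    {x y z w : K} (hx : x ≠ 0) (hy : y ≠ 0) (hz : z ≠ 0) (hw : w ≠ 0)
    (h : IsSingularZero (chartPoly (fun i => b i ^ 2) ((∑ i, b i) ^ 2)) ![x, y, z, w]) :
    ∃ c : Fin 5 → K, (∀ i, c i ^ 2 = b i ^ 2) ∧ ∑ i, c i = ∑ i, b i ∧
      c 0 = x * y * z * w * c 4 ∧ c 1 = y * z * w * c 4 ∧ c 2 = z * w * c 4 ∧ c 3 = w * c 4 := by
  obtain ⟨h, h0, h1, h2, h3⟩ := (isSingularZero_chartPoly_iff _ _ _ _ _ _).1 h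
  set s := ∑ i, b i
  set A := 1 + w + z * w + y * z * w + x * y * z * w with hA
  set B := b 0 ^ 2 + b 1 ^ 2 * x + b 2 ^ 2 * (x * y) + b 3 ^ 2 * (x * y * z) +
    b 4 ^ 2 * (x * y * z * w) with hB
  have hAB : A * B ≠ 0 := by
    rw [h]
    exact mul_ne_zero (pow_ne_zero 2 hs) (by positivity)
  have hA0 : A ≠ 0 := left_ne_zero_of_mul hAB
  -- Differences of consecutive logarithmic derivatives isolate one monomial at a time: in
  -- homogeneous terms, X_i · ∑ a_j/X_j = (∑ X_j) · a_i/X_i.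
  have e0 : x * y * z * w * B = A * b 0 ^ 2 := by linear_combination x * h0 - h
  have e1 : y * z * w * B = A * (b 1 ^ 2 * x) := by linear_combination y * h1 - x * h0
  have e2 : z * w * B = A * (b 2 ^ 2 * (x * y)) := by linear_combination z * h2 - y * h1
  have e3 : w * B = A * (b 3 ^ 2 * (x * y * z)) := by linear_combination w * h3 - z * h2
  have e4 : B = A * (b 4 ^ 2 * (x * y * z * w)) := by linear_combination h - w * h3
  have f0 : (x * y * z * w * b 4) ^ 2 = b 0 ^ 2 := by
    apply mul_left_cancel₀ hA0
    linear_combination e0 - x * y * z * w * e4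
  have f1 : (y * z * w * b 4) ^ 2 = b 1 ^ 2 := by
    apply mul_left_cancel₀ (mul_ne_zero hA0 hx)
    linear_combination e1 - y * z * w * e4
  have f2 : (z * w * b 4) ^ 2 = b 2 ^ 2 := by
    apply mul_left_cancel₀ (mul_ne_zero (mul_ne_zero hA0 hx) hy)
    linear_combination e2 - z * w * e4
  have f3 : (w * b 4) ^ 2 = b 3 ^ 2 := by
    apply mul_left_cancel₀ (mul_ne_zero (mul_ne_zero (mul_ne_zero hA0 hx) hy) hz)
    linear_combination e3 - w * e4
  have f : (A * b 4) ^ 2 = s ^ 2 := by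
    apply mul_left_cancel₀ (mul_ne_zero (mul_ne_zero (mul_ne_zero hx hy) hz) hw)
    linear_combination h - A * e4
  -- The overall sign is chosen here so that the coordinate sum is s and not -s.
  obtain ⟨t, ht, hts⟩ : ∃ t, t ^ 2 = b 4 ^ 2 ∧ A * t = s := by
    rcases sq_eq_sq_iff_eq_or_eq_neg.1 f with f | f
    · exact ⟨b 4, rfl, f⟩
    · exact ⟨-b 4, by ring, by linear_combination -f⟩
  refine ⟨![x * y * z * w * t, y * z * w * t, z * w * t, w * t, t], ?_, ?_, by simp⟩
  · intro i
    fin_cases i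
    · exact (by linear_combination f0 + (x * y * z * w) ^ 2 * ht : (x * y * z * w * t) ^ 2 = b 0 ^ 2)
    · exact (by linear_combination f1 + (y * z * w) ^ 2 * ht : (y * z * w * t) ^ 2 = b 1 ^ 2)
    · exact (by linear_combination f2 + (z * w) ^ 2 * ht : (z * w * t) ^ 2 = b 2 ^ 2)
    · exact (by linear_combination f3 + (w) ^ 2 * ht : (w * t) ^ 2 = b 3 ^ 2)
    · exact ht
  · rw [← hts, Fin.sum_univ_five, hA]
    simp
    ring

/-- If x or w vanishes, the equations force a_0 = 0. So y or z vanishes; then A = B = 0, and one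
remaining derivative reduces to s·x·w·z = 0 or s·x·w·y = 0, so the other of the two vanishes as
well. -/
theorem eq_of_isSingularZero_of_eq_zero {a : Fin 5 → K} {s : K} (ha : ∀ i, a i ≠ 0) (hs : s ≠ 0)
    {x y z w : K} (hp : x = 0 ∨ y = 0 ∨ z = 0 ∨ w = 0)
    (h : IsSingularZero (chartPoly a s) ![x, y, z, w]) :
    x = -(a 0 / a 1) ∧ y = 0 ∧ z = 0 ∧ w = -1 := by
  obtain ⟨h, h0, h1, h2, h3⟩ := (isSingularZero_chartPoly_iff _ _ _ _ _ _).1 h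
  have hx : x ≠ 0 := by
    rintro rfl
    apply ha 0
    linear_combination h - w * h3
  have hw : w ≠ 0 := by
    rintro rfl
    apply ha 0
    linear_combination h - x * h0
  have fin : y = 0 → z = 0 → a 0 + a 1 * x = 0 → 1 + w = 0 →
      x = -(a 0 / a 1) ∧ y = 0 ∧ z = 0 ∧ w = -1 := by
    intro hy hz h4 h5
    refine ⟨?_, hy, hz, by linear_combination h5⟩
    rw [← neg_div, eq_div_iff (ha 1)]
    linear_combination h4
  have hyz : y = 0 ∨ z = 0 := by tauto
  rcases hyz with rfl | rfl
  · have hA : 1 + w + z * w = 0 := by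
      apply mul_right_cancel₀ (ha 1)
      linear_combination h0
    have hz : 1 + z ≠ 0 := by
      intro hz
      apply one_ne_zero (α := K)
      linear_combination hA - w * hz
    have hB : a 0 + a 1 * x = 0 := by
      apply mul_left_cancel₀ hz
      linear_combination h3
    have hz0 : z = 0 := by
      apply mul_left_cancel₀ (mul_ne_zero (mul_ne_zero hs hx) hw)
      linear_combination (z * w + x * z * w) * hB + (a 2 * x + a 3 * (x * z)
        + a 4 * (x * z * w)) * hA - h1
    refine fin rfl hz0 hB ?_
    rw [← hA, hz0]
    ring
  · have hB : a 0 + a 1 * x + a 2 * (x * y) = 0 := by linear_combination h3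
    have hc : a 1 + a 2 * y ≠ 0 := by
      intro hc
      apply ha 0
      linear_combination hB - x * hc
    have hA : 1 + w = 0 := by
      apply mul_right_cancel₀ hc
      linear_combination h0
    have hy0 : y = 0 := by
      apply mul_left_cancel₀ (mul_ne_zero (mul_ne_zero hs hx) hw)
      linear_combination (w + y * w + x * y * w) * hB + (a 3 * (x * y) + a 4 * (x * y * w)) * hA
        - h2
    refine fin hy0 rfl ?_ hA
    rw [← hB, hy0]
    ring

/-! ### Hessians. -/

/-- The Hessian matrix of `chartPoly a s` at `(x, y, z, w)`. -/
def chartHessian (a : Fin 5 → K) (s x y z w : K) : Matrix (Fin 4) (Fin 4) K :=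
  let A := 1 + w + z * w + y * z * w + x * y * z * w
  let Ax := y * z * w
  let Ay := z * w * (1 + x)
  let Az := w * (1 + y + x * y)
  let Aw := 1 + z + y * z + x * y * z
  let Axy := z * w
  let Axz := y * w
  let Axw := y * z
  let Ayz := w * (1 + x)
  let Ayw := z * (1 + x)
  let Azw := 1 + y + x * y
  let B := a 0 + a 1 * x + a 2 * (x * y) + a 3 * (x * y * z) + a 4 * (x * y * z * w)
  let Bx := a 1 + a 2 * y + a 3 * (y * z) + a 4 * (y * z * w)
  let By := x * (a 2 + a 3 * z + a 4 * (z * w))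
  let Bz := x * y * (a 3 + a 4 * w)
  let Bw := a 4 * (x * y * z)
  let Bxy := a 2 + a 3 * z + a 4 * (z * w)
  let Bxz := y * (a 3 + a 4 * w)
  let Bxw := a 4 * (y * z)
  let Byz := x * (a 3 + a 4 * w)
  let Byw := a 4 * (x * z)
  let Bzw := a 4 * (x * y)
  !![2 * Ax * Bx,
      Axy * B + Ax * By + Ay * Bx + A * Bxy - s * (z * w),
      Axz * B + Ax * Bz + Az * Bx + A * Bxz - s * (y * w),
      Axw * B + Ax * Bw + Aw * Bx + A * Bxw - s * (y * z);
      Axy * B + Ax * By + Ay * Bx + A * Bxy - s * (z * w),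
      2 * Ay * By,
      Ayz * B + Ay * Bz + Az * By + A * Byz - s * (x * w),
      Ayw * B + Ay * Bw + Aw * By + A * Byw - s * (x * z);
      Axz * B + Ax * Bz + Az * Bx + A * Bxz - s * (y * w),
      Ayz * B + Ay * Bz + Az * By + A * Byz - s * (x * w),
      2 * Az * Bz,
      Azw * B + Az * Bw + Aw * Bz + A * Bzw - s * (x * y);
      Axw * B + Ax * Bw + Aw * Bx + A * Bxw - s * (y * z),
      Ayw * B + Ay * Bw + Aw * By + A * Byw - s * (x * z),
      Azw * B + Az * Bw + Aw * Bz + A * Bzw - s * (x * y),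
      2 * Aw * Bw]

theorem hessian_chartPoly_zero (a : Fin 5 → K) (s x y z w : K) (i : Fin 4) :
    eval ![x, y, z, w] (pderiv i (pderiv 0 (chartPoly a s))) = chartHessian a s x y z w i 0 := by
  have e : pderiv 0 (chartPoly a s) = X 1 * X 2 * X 3 * inverseFactor a + sumFactor K *
      (C (a 1) + C (a 2) * X 1 + C (a 3) * (X 1 * X 2) + C (a 4) * (X 1 * X 2 * X 3))
      - C s * (X 1 * X 2 * X 3) := by
    simp [chartPoly, sumFactor, inverseFactor, Derivation.leibniz, pderiv_X]
    ring
  rw [e]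
  fin_cases i <;> simp [chartHessian, sumFactor, inverseFactor, Derivation.leibniz, pderiv_X] <;>
    ring

theorem hessian_chartPoly_one (a : Fin 5 → K) (s x y z w : K) (i : Fin 4) :
    eval ![x, y, z, w] (pderiv i (pderiv 1 (chartPoly a s))) = chartHessian a s x y z w i 1 := by
  have e : pderiv 1 (chartPoly a s) = X 2 * X 3 * (1 + X 0) * inverseFactor a + sumFactor K *
      (X 0 * (C (a 2) + C (a 3) * X 2 + C (a 4) * (X 2 * X 3)))
      - C s * (X 0 * X 2 * X 3) := by
    simp [chartPoly, sumFactor, inverseFactor, Derivation.leibniz, pderiv_X]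
    ring
  rw [e]
  fin_cases i <;> simp [chartHessian, sumFactor, inverseFactor, Derivation.leibniz, pderiv_X] <;>
    ring

theorem hessian_chartPoly_two (a : Fin 5 → K) (s x y z w : K) (i : Fin 4) :
    eval ![x, y, z, w] (pderiv i (pderiv 2 (chartPoly a s))) = chartHessian a s x y z w i 2 := by
  have e : pderiv 2 (chartPoly a s) = X 3 * (1 + X 1 + X 0 * X 1) * inverseFactor a +
      sumFactor K * (X 0 * X 1 * (C (a 3) + C (a 4) * X 3)) - C s * (X 0 * X 1 * X 3) := by
    simp [chartPoly, sumFactor, inverseFactor, Derivation.leibniz, pderiv_X]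
    ring
  rw [e]
  fin_cases i <;> simp [chartHessian, sumFactor, inverseFactor, Derivation.leibniz, pderiv_X] <;>
    ring

theorem hessian_chartPoly_three (a : Fin 5 → K) (s x y z w : K) (i : Fin 4) :
    eval ![x, y, z, w] (pderiv i (pderiv 3 (chartPoly a s))) = chartHessian a s x y z w i 3 := by
  have e : pderiv 3 (chartPoly a s) = (1 + X 2 + X 1 * X 2 + X 0 * X 1 * X 2) *
      inverseFactor a + sumFactor K * (C (a 4) * (X 0 * X 1 * X 2))
      - C s * (X 0 * X 1 * X 2) := by
    simp [chartPoly, sumFactor, inverseFactor, Derivation.leibniz, pderiv_X]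
    ring
  rw [e]
  fin_cases i <;> simp [chartHessian, sumFactor, inverseFactor, Derivation.leibniz, pderiv_X] <;>
    ring

theorem hessian_chartPoly (a : Fin 5 → K) (s x y z w : K) :
    (Matrix.of fun i j => eval ![x, y, z, w] (pderiv i (pderiv j (chartPoly a s)))) =
      chartHessian a s x y z w := by
  ext i j
  fin_cases j
  · exact hessian_chartPoly_zero a s x y z w i
  · exact hessian_chartPoly_one a s x y z w i
  · exact hessian_chartPoly_two a s x y z w i
  · exact hessian_chartPoly_three a s x y z w i

theorem det_fin_four {R : Type*} [CommRing R] (M : Matrix (Fin 4) (Fin 4) R) :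
    M.det =
      M 0 0 * (M 1 1 * (M 2 2 * M 3 3 - M 2 3 * M 3 2) - M 1 2 * (M 2 1 * M 3 3 - M 2 3 * M 3 1)
        + M 1 3 * (M 2 1 * M 3 2 - M 2 2 * M 3 1))
      - M 0 1 * (M 1 0 * (M 2 2 * M 3 3 - M 2 3 * M 3 2) - M 1 2 * (M 2 0 * M 3 3 - M 2 3 * M 3 0)
        + M 1 3 * (M 2 0 * M 3 2 - M 2 2 * M 3 0))
      + M 0 2 * (M 1 0 * (M 2 1 * M 3 3 - M 2 3 * M 3 1) - M 1 1 * (M 2 0 * M 3 3 - M 2 3 * M 3 0)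
        + M 1 3 * (M 2 0 * M 3 1 - M 2 1 * M 3 0))
      - M 0 3 * (M 1 0 * (M 2 1 * M 3 2 - M 2 2 * M 3 1) - M 1 1 * (M 2 0 * M 3 2 - M 2 2 * M 3 0)
        + M 1 2 * (M 2 0 * M 3 1 - M 2 1 * M 3 0)) := by
  have h01 : (0 : Fin 4).succAbove 0 = 1 := rfl
  have h02 : (0 : Fin 4).succAbove 1 = 2 := rfl
  have h03 : (0 : Fin 4).succAbove 2 = 3 := rfl
  have h10 : (1 : Fin 4).succAbove 0 = 0 := rfl
  have h11 : (1 : Fin 4).succAbove 1 = 2 := rfl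
  have h12 : (1 : Fin 4).succAbove 2 = 3 := rfl
  have h20 : (2 : Fin 4).succAbove 0 = 0 := rfl
  have h21 : (2 : Fin 4).succAbove 1 = 1 := rfl
  have h22 : (2 : Fin 4).succAbove 2 = 3 := rfl
  have h30 : (3 : Fin 4).succAbove 0 = 0 := rfl
  have h31 : (3 : Fin 4).succAbove 1 = 1 := rfl
  have h32 : (3 : Fin 4).succAbove 2 = 2 := rfl
  have e0 : (0 : Fin 3).succ = 1 := rfl
  have e1 : (1 : Fin 3).succ = 2 := rfl
  have e2 : (2 : Fin 3).succ = 3 := rfl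
  have v3 : ((3 : Fin 4) : ℕ) = 3 := rfl
  rw [Matrix.det_succ_row_zero, Fin.sum_univ_four]
  simp only [Matrix.det_fin_three, Matrix.submatrix_apply, h01, h02, h03, h10, h11, h12, h20,
    h21, h22, h30, h31, h32, e0, e1, e2, v3, Fin.val_zero, Fin.val_one, Fin.val_two]
  ring

/-- Up to the factor k, the entries are S_min(i,j)·(A - S_max(i,j)), the covariance of a Brownian
bridge of length A. The determinant is governed by the product of the increments of 0, S₀, …, S₃, A.
-/
theorem det_bridge (S₀ S₁ S₂ S₃ A k : K) :
    Matrix.det !![k * (S₀ * (A - S₀)), k * (S₀ * (A - S₁)), k * (S₀ * (A - S₂)),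
        k * (S₀ * (A - S₃));
      k * (S₀ * (A - S₁)), k * (S₁ * (A - S₁)), k * (S₁ * (A - S₂)), k * (S₁ * (A - S₃));
      k * (S₀ * (A - S₂)), k * (S₁ * (A - S₂)), k * (S₂ * (A - S₂)), k * (S₂ * (A - S₃));
      k * (S₀ * (A - S₃)), k * (S₁ * (A - S₃)), k * (S₂ * (A - S₃)), k * (S₃ * (A - S₃))]
      = k ^ 4 * A ^ 3 * (S₀ * (S₁ - S₀) * (S₂ - S₁) * (S₃ - S₂) * (A - S₃)) := by
  rw [det_fin_four]
  simp only [Matrix.of_apply, Matrix.cons_val]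
  ring


/-! ### Nondegeneracy at the singular points. -/

section LocalNodes

theorem isSingularZero_torus (x y z w t : K) :
    IsSingularZero (chartPoly
      ![(t * (x * y * z * w)) ^ 2, (t * (y * z * w)) ^ 2, (t * (z * w)) ^ 2, (t * w) ^ 2, t ^ 2]
      ((t * (1 + w + z * w + y * z * w + x * y * z * w)) ^ 2)) ![x, y, z, w] := by
  rw [isSingularZero_chartPoly_iff]
  simp only [Matrix.cons_val]
  refine ⟨?_, ?_, ?_, ?_, ?_⟩ <;> ring

theorem det_chartHessian_torus (h2 : (2 : K) ≠ 0) {x y z w t : K} (hx : x ≠ 0) (hy : y ≠ 0)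
    (hz : z ≠ 0) (hw : w ≠ 0) (ht : t ≠ 0)
    (hA : 1 + w + z * w + y * z * w + x * y * z * w ≠ 0) :
    (chartHessian
      ![(t * (x * y * z * w)) ^ 2, (t * (y * z * w)) ^ 2, (t * (z * w)) ^ 2, (t * w) ^ 2, t ^ 2]
      ((t * (1 + w + z * w + y * z * w + x * y * z * w)) ^ 2) x y z w).det ≠ 0 := by
  set M := chartHessian
      ![(t * (x * y * z * w)) ^ 2, (t * (y * z * w)) ^ 2, (t * (z * w)) ^ 2, (t * w) ^ 2, t ^ 2]
      ((t * (1 + w + z * w + y * z * w + x * y * z * w)) ^ 2) x y z w with hM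
  have key := det_bridge (x * y * z * w) (x * y * z * w + y * z * w)
    (x * y * z * w + y * z * w + z * w) (x * y * z * w + y * z * w + z * w + w)
    (1 + w + z * w + y * z * w + x * y * z * w) (2 * t ^ 2 * (x * y * z * w))
  -- Scaling rows and columns by the coordinates gives the logarithmic Hessian. The S_i are partial
  -- sums of xyzw, yzw, zw, w, 1, so all increments are nonzero.
  have e : (Matrix.of fun i j => ![x, y, z, w] i *
      (Matrix.of fun i j => ![x, y, z, w] j * M i j) i j).det ≠ 0 := by
    refine ne_of_eq_of_ne (Eq.trans ?_ key) ?_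
    · congr 1
      ext i j
      fin_cases i <;> fin_cases j <;> simp [hM, chartHessian] <;> ring
    · have h1 : x * y * z * w + y * z * w - x * y * z * w ≠ 0 := by
        convert mul_ne_zero (mul_ne_zero hy hz) hw using 1; ring
      have h2' : x * y * z * w + y * z * w + z * w - (x * y * z * w + y * z * w) ≠ 0 := by
        convert mul_ne_zero hz hw using 1; ring
      have h3 : x * y * z * w + y * z * w + z * w + w - (x * y * z * w + y * z * w + z * w) ≠ 0 := by
        convert hw using 1; ring
      have h4 : 1 + w + z * w + y * z * w + x * y * z * w
          - (x * y * z * w + y * z * w + z * w + w) ≠ 0 := by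
        convert one_ne_zero (α := K) using 1; ring
      positivity
  rw [Matrix.det_mul_column, Matrix.det_mul_row] at e
  exact right_ne_zero_of_mul (right_ne_zero_of_mul e)

theorem isSingularZero_boundary {a : Fin 5 → K} (s : K) (ha : a 1 ≠ 0) :
    IsSingularZero (chartPoly a s) ![-(a 0 / a 1), 0, 0, -1] := by
  rw [isSingularZero_chartPoly_iff]
  refine ⟨?_, ?_, ?_, ?_, ?_⟩ <;> field_simp <;> ring

/-- At this point A, B, y, z are local coordinates and the quadratic part of F is AB - s(a_0/a_1)yz,
a sum of two hyperbolic planes. -/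
theorem det_chartHessian_boundary {a : Fin 5 → K} (s : K) (ha : a 1 ≠ 0) :
    (chartHessian a s (-(a 0 / a 1)) 0 0 (-1)).det = (a 0 * s) ^ 2 := by
  rw [det_fin_four]
  simp only [chartHessian, Matrix.of_apply, Matrix.cons_val]
  field_simp
  ring

end LocalNodes

/-! ### Nodes of the hypersurface. -/

section Nodes

theorem chartIdeal_phi {b : Fin 5 → K} (hb : ∀ i, b i ≠ 0) (ς : Equiv.Perm (Fin 5)) :
    chartIdeal (phi b) ς =
      Ideal.span {chartPoly (fun i => b (ς i) ^ 2) ((∑ i, b (ς i)) ^ 2)} := by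
  have h (i : Fin 5) : phi b i.castSucc = b i ^ 2 := Fin.snoc_castSucc (α := fun _ => K) _ _ _
  have hl : phi b (Fin.last 5) = (∑ i, b i) ^ 2 := Fin.snoc_last (α := fun _ => K) _ _
  rw [chartIdeal_eq_span, hl, Equiv.sum_comp ς b]
  · simp only [h]
  · rw [h]
    exact pow_ne_zero 2 (hb _)

/-- The coordinates of the node on the toric boundary in the chart of `ς`. -/
def boundaryCoords (b : Fin 5 → K) (ς : Equiv.Perm (Fin 5)) : Fin 4 → K :=
  ![-(b (ς 0) ^ 2 / b (ς 1) ^ 2), 0, 0, -1]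

/-- The node on the toric boundary in the chart of `ς`. -/
def boundaryNode (b : Fin 5 → K) (ς : Equiv.Perm (Fin 5)) : ToricVariety K :=
  chartPoint ς (boundaryCoords b ς)

theorem boundaryNode_mem_nodes {b : Fin 5 → K} (hb : ∀ i, b i ≠ 0) (hs : ∑ i, b i ≠ 0)
    (ς : Equiv.Perm (Fin 5)) : boundaryNode b ς ∈ nodes (phi b) := by
  refine ⟨ς, _, rfl, ?_⟩
  have h1 := pow_ne_zero 2 (hb (ς 1))
  rw [chartIdeal_phi hb]
  refine isAffineNode_span
    (isSingularZero_boundary (a := fun i => b (ς i) ^ 2) ((∑ i, b (ς i)) ^ 2) h1) ?_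
  rw [boundaryCoords, hessian_chartPoly,
    det_chartHessian_boundary (a := fun i => b (ς i) ^ 2) _ h1, Equiv.sum_comp ς b]
  exact pow_ne_zero 2 (mul_ne_zero (pow_ne_zero 2 (hb _)) (pow_ne_zero 2 hs))

theorem boundaryNode_notMem_torus (b : Fin 5 → K) (ς : Equiv.Perm (Fin 5)) :
    boundaryNode b ς ∉ torus K := by
  rw [boundaryNode, chartPoint_mem_torus_iff]
  exact fun h => h 1 rfl

theorem torusPoint_mem_nodes (h2 : (2 : K) ≠ 0) {b c : Fin 5 → K} (hb : ∀ i, b i ≠ 0)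
    (hs : ∑ i, b i ≠ 0) (hc : ∀ i, c i ^ 2 = b i ^ 2) (hcs : ∑ i, c i = ∑ i, b i) :
    torusPoint c ∈ nodes (phi b) := by
  have hc0 (i) : c i ≠ 0 := by
    have := pow_ne_zero 2 (hb i)
    rw [← hc] at this
    exact ne_zero_pow two_ne_zero this
  refine ⟨1, _, rfl, ?_⟩
  have hb' : (fun i => b ((1 : Equiv.Perm (Fin 5)) i) ^ 2) = fun i => c i ^ 2 :=
    funext fun i => (hc i).symm
  rw [chartIdeal_phi hb, hb', Equiv.sum_comp _ b, ← hcs]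
  have h0 := hc0 0
  have h1 := hc0 1
  have h2' := hc0 2
  have h3 := hc0 3
  have h4 := hc0 4
  -- All data are rewritten through the chart coordinates and t = `c 4`, the form required by
  -- `isSingularZero_torus`.
  have ep : (fun l : Fin 4 => c l.castSucc / c l.succ) =
      ![c 0 / c 1, c 1 / c 2, c 2 / c 3, c 3 / c 4] := by
    funext l
    fin_cases l <;> rfl
  have e3 : c 3 = c 4 * (c 3 / c 4) := by field_simp
  have e2 : c 2 = c 4 * (c 2 / c 3 * (c 3 / c 4)) := by field_simp
  have e1 : c 1 = c 4 * (c 1 / c 2 * (c 2 / c 3) * (c 3 / c 4)) := by field_simp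
  have e0 : c 0 = c 4 * (c 0 / c 1 * (c 1 / c 2) * (c 2 / c 3) * (c 3 / c 4)) := by field_simp
  have es : ∑ i, c i = c 4 * (1 + c 3 / c 4 + c 2 / c 3 * (c 3 / c 4)
      + c 1 / c 2 * (c 2 / c 3) * (c 3 / c 4)
      + c 0 / c 1 * (c 1 / c 2) * (c 2 / c 3) * (c 3 / c 4)) := by
    rw [Fin.sum_univ_five]
    linear_combination e0 + e1 + e2 + e3
  have ea : (fun i => c i ^ 2) =
      ![(c 4 * (c 0 / c 1 * (c 1 / c 2) * (c 2 / c 3) * (c 3 / c 4))) ^ 2,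
        (c 4 * (c 1 / c 2 * (c 2 / c 3) * (c 3 / c 4))) ^ 2,
        (c 4 * (c 2 / c 3 * (c 3 / c 4))) ^ 2, (c 4 * (c 3 / c 4)) ^ 2, c 4 ^ 2] := by
    rw [← e0, ← e1, ← e2, ← e3]
    funext i
    fin_cases i <;> rfl
  have hA := right_ne_zero_of_mul (es ▸ hcs ▸ hs)
  rw [ep, ea, es]
  refine isAffineNode_span (isSingularZero_torus _ _ _ _ _) ?_
  rw [hessian_chartPoly]
  exact det_chartHessian_torus h2 (div_ne_zero h0 h1) (div_ne_zero h1 h2') (div_ne_zero h2' h3)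
    (div_ne_zero h3 h4) h4 hA

theorem signChange_sq (b : Fin 5 → K) (J : Finset (Fin 5)) (i : Fin 5) :
    signChange b J i ^ 2 = b i ^ 2 := by
  unfold signChange
  split_ifs <;> ring

theorem sum_signChange (b : Fin 5 → K) (J : Finset (Fin 5)) :
    ∑ i, signChange b J i = ∑ i, b i - 2 * ∑ i ∈ J, b i := by
  have : ∑ i ∈ J, b i = ∑ i, if i ∈ J then b i else 0 := by simp
  rw [this, Finset.mul_sum, ← Finset.sum_sub_distrib]
  refine Finset.sum_congr rfl fun i _ => ?_
  unfold signChange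
  split_ifs <;> ring

theorem exists_eq_signChange {b c : Fin 5 → K} (hc : ∀ i, c i ^ 2 = b i ^ 2) :
    ∃ J, c = signChange b J := by
  classical
  refine ⟨Finset.univ.filter fun i => c i = -b i, funext fun i => ?_⟩
  rcases sq_eq_sq_iff_eq_or_eq_neg.1 (hc i) with h | h
  · by_cases h' : c i = -b i
    · simp [signChange, h']
    · rw [signChange, if_neg (by simpa using h'), h]
  · simp [signChange, h]

theorem eq_boundaryCoords_or_of_isAffineNode (h2 : (2 : K) ≠ 0) {b : Fin 5 → K}
    (hb : ∀ i, b i ≠ 0) (hs : ∑ i, b i ≠ 0) {ς : Equiv.Perm (Fin 5)} {p : Fin 4 → K}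
    (hp : IsAffineNode (chartIdeal (phi b) ς) p) :
    p = boundaryCoords b ς ∨
      ∃ J, ∑ i ∈ J, b i = 0 ∧ chartPoint ς p = torusPoint (signChange b J) := by
  rw [chartIdeal_phi hb] at hp
  have hsing := hp.isSingularZero
  have hs' : ∑ i, b (ς i) ≠ 0 := by rwa [Equiv.sum_comp ς b]
  obtain ⟨x, y, z, w, rfl⟩ : ∃ x y z w, p = ![x, y, z, w] :=
    ⟨p 0, p 1, p 2, p 3, by funext l; fin_cases l <;> rfl⟩
  by_cases h0 : x = 0 ∨ y = 0 ∨ z = 0 ∨ w = 0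
  · left
    obtain ⟨rfl, rfl, rfl, rfl⟩ := eq_of_isSingularZero_of_eq_zero
      (fun i => pow_ne_zero 2 (hb (ς i))) (pow_ne_zero 2 hs') h0 hsing
    rfl
  · right
    push Not at h0
    obtain ⟨hx, hy, hz, hw⟩ := h0
    obtain ⟨c, hc, hcs, c0, c1, c2, c3⟩ :=
      exists_signs_of_isSingularZero (b := fun i => b (ς i)) hs' hx hy hz hw hsing
    have hcne (i) : c i ≠ 0 := by
      have := pow_ne_zero 2 (hb (ς i))
      rw [← hc] at this
      exact ne_zero_pow two_ne_zero this
    obtain ⟨J, hJ⟩ := exists_eq_signChange (b := b) (c := c ∘ ς.symm)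
      fun i => by simpa using hc (ς.symm i)
    refine ⟨J, ?_, ?_⟩
    · have := sum_signChange b J
      rw [← hJ, ← Equiv.sum_comp ς] at this
      simp only [Function.comp_apply, Equiv.symm_apply_apply, hcs, Equiv.sum_comp ς b] at this
      refine (mul_eq_zero.1 ?_).resolve_left h2
      linear_combination this
    · rw [← hJ, torusPoint_eq_chartPoint ς (c := c ∘ ς.symm) fun i => hcne _]
      congr 1
      have h4 := hcne 4
      funext l
      fin_cases l <;> simp [c0, c1, c2, c3] <;> field_simp

end Nodes

/-! ### Counting the nodes. -/

section Count

/-- The position of `k` in the ordered partition `{0, 1}, {2}, {3, 4}`. -/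
def block : Fin 5 → Fin 3 := ![0, 0, 1, 2, 2]

/-- Only the coordinates at 1 and 2 vanish, and these are the ones that cross from one block to the
next. The zero pattern of the ratios thus recovers the ordered partition. -/
theorem ratio_boundaryNode_eq_zero_iff {b : Fin 5 → K} (hb : ∀ i, b i ≠ 0)
    (ς : Equiv.Perm (Fin 5)) (i j : Fin 5) :
    ratio (boundaryNode b ς) i j = some 0 ↔ block (ς.symm i) < block (ς.symm j) := by
  have h (m : Fin 4) : boundaryCoords b ς m = 0 ↔ m = 1 ∨ m = 2 := by
    fin_cases m <;> simp [boundaryCoords, hb]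
  rw [boundaryNode, ratio_chartPoint_eq_zero_iff]
  simp only [intervalProd, Finset.prod_eq_zero_iff, Finset.mem_filter, Finset.mem_univ, true_and, h]
  generalize ς.symm i = k
  generalize ς.symm j = l
  revert k l
  unfold block
  decide

theorem block_eq_of_lt_iff : ∀ π : Equiv.Perm (Fin 5),
    (∀ k l, block (π k) < block (π l) ↔ block k < block l) → ∀ k, block (π k) = block k := by
  decide +kernel

theorem block_perm_cases : ∀ π : Equiv.Perm (Fin 5), (∀ k, block (π k) = block k) →
    π 2 = 2 ∧ (π 0 = 0 ∧ π 1 = 1 ∨ π 0 = 1 ∧ π 1 = 0) ∧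
      (π 3 = 3 ∧ π 4 = 4 ∨ π 3 = 4 ∧ π 4 = 3) := by
  decide +kernel

theorem boundaryNode_eq_iff {b : Fin 5 → K} (hb : ∀ i, b i ≠ 0) (ς τ : Equiv.Perm (Fin 5)) :
    boundaryNode b ς = boundaryNode b τ ↔ ∀ k, block (ς.symm (τ k)) = block k := by
  constructor
  · intro h
    refine block_eq_of_lt_iff (τ.trans ς.symm) fun k l => ?_
    have := ratio_boundaryNode_eq_zero_iff hb ς (τ k) (τ l)
    rw [h, ratio_boundaryNode_eq_zero_iff hb] at this
    simpa using this.symm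
  · intro h
    have hZ : ∀ l ∈ ({1, 2} : Finset (Fin 4)), ∀ k, ς.symm (τ k) ≤ l.castSucc ↔ k ≤ l.castSucc := by
      intro l hl k
      have hk := h k
      generalize ς.symm (τ k) = m at *
      revert l k m
      unfold block
      decide
    -- Chosen so that d_0/d_1 and d_3/d_4 are the two nonzero coordinates in the chart of `ς`; the
    -- value at 2 is arbitrary. Swapping inside a block inverts the ratio, which matches the formula
    -- in the chart of `τ`.
    let d : Fin 5 → K := ![b (ς 0) ^ 2, -b (ς 1) ^ 2, 1, 1, -1]
    have hd : ∀ i, d i ≠ 0 := by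
      intro i
      fin_cases i <;> simp [d, hb]
    have hτ (k) : τ k = ς (τ.trans ς.symm k) := by simp
    have e := chartPoint_orbitPoint_eq hZ (c := d ∘ ς.symm) fun i => hd _
    simp only [boundaryNode]
    convert e using 2
    · funext l
      fin_cases l <;> simp [boundaryCoords, orbitPoint, d, div_neg]
    · obtain ⟨-, h01, h34⟩ := block_perm_cases (τ.trans ς.symm) h
      simp only [Equiv.trans_apply] at h01 h34
      have e0 : orbitPoint τ {1, 2} (d ∘ ς.symm) 0 = boundaryCoords b τ 0 := by
        simp only [boundaryCoords, orbitPoint]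
        rcases h01 with ⟨h0, h1⟩ | ⟨h0, h1⟩ <;> rw [hτ 0, hτ 1] <;>
          simp [h0, h1, d, div_neg, neg_div]
      have e3 : orbitPoint τ {1, 2} (d ∘ ς.symm) 3 = boundaryCoords b τ 3 := by
        simp only [boundaryCoords, orbitPoint]
        rcases h34 with ⟨h0, h1⟩ | ⟨h0, h1⟩ <;> simp [h0, h1, d]
      funext l
      fin_cases l
      · exact e0.symm
      · rfl
      · rfl
      · exact e3.symm

/-- Sorting inside the two blocks of size two gives representatives, which are unique by
`block_perm_cases`. -/
theorem exists_increasing_rep : ∀ ς : Equiv.Perm (Fin 5), ∃ τ : Equiv.Perm (Fin 5),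
    (τ 0 < τ 1 ∧ τ 3 < τ 4) ∧ ∀ k, block (ς.symm (τ k)) = block k := by
  decide +kernel

theorem encard_range_boundaryNode {b : Fin 5 → K} (hb : ∀ i, b i ≠ 0) :
    (Set.range (boundaryNode b)).encard = 30 := by
  set S := (Finset.univ : Finset (Equiv.Perm (Fin 5))).filter fun ς => ς 0 < ς 1 ∧ ς 3 < ς 4
    with hS
  have hcard : S.card = 30 := by decide +kernel
  have himage : Set.range (boundaryNode b) = boundaryNode b '' (S : Set (Equiv.Perm (Fin 5))) := by
    refine subset_antisymm ?_ (Set.image_subset_range _ _)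
    rintro _ ⟨ς, rfl⟩
    obtain ⟨τ, hτ, h⟩ := exists_increasing_rep ς
    exact ⟨τ, by simpa [hS] using hτ, ((boundaryNode_eq_iff hb ς τ).2 h).symm⟩
  have hinj : Set.InjOn (boundaryNode b) (S : Set (Equiv.Perm (Fin 5))) := by
    intro ς hς τ hτ h
    simp only [hS, Finset.coe_filter, Finset.mem_univ, true_and, Set.mem_ofPred_eq] at hς hτ
    obtain ⟨e2, e01, e34⟩ :=
      block_perm_cases (τ.trans ς.symm) ((boundaryNode_eq_iff hb ς τ).1 h)
    simp only [Equiv.trans_apply, Equiv.symm_apply_eq] at e2 e01 e34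
    have h01 : τ 0 = ς 0 ∧ τ 1 = ς 1 :=
      e01.resolve_right fun h => (hς.1.trans (h.1 ▸ h.2 ▸ hτ.1)).false
    have h34 : τ 3 = ς 3 ∧ τ 4 = ς 4 :=
      e34.resolve_right fun h => (hς.2.trans (h.1 ▸ h.2 ▸ hτ.2)).false
    ext1 k
    fin_cases k
    · exact h01.1.symm
    · exact h01.2.symm
    · exact e2.symm
    · exact h34.1.symm
    · exact h34.2.symm
  rw [himage, hinj.encard_image, Set.encard_coe_eq_coe_finsetCard, hcard]
  rfl

theorem nodes_diff_torus (h2 : (2 : K) ≠ 0) {b : Fin 5 → K} (hb : ∀ i, b i ≠ 0)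
    (hs : ∑ i, b i ≠ 0) : nodes (phi b) \ torus K = Set.range (boundaryNode b) := by
  ext P
  constructor
  · rintro ⟨⟨ς, p, rfl, hp⟩, hP⟩
    rcases eq_boundaryCoords_or_of_isAffineNode h2 hb hs hp with rfl | ⟨J, -, h⟩
    · exact ⟨ς, rfl⟩
    · refine absurd ⟨_, fun i => ?_, h⟩ hP
      unfold signChange
      split_ifs <;> simp [hb]
  · rintro ⟨ς, rfl⟩
    exact ⟨boundaryNode_mem_nodes hb hs ς, boundaryNode_notMem_torus b ς⟩

theorem signChange_ne_zero {b : Fin 5 → K} (hb : ∀ i, b i ≠ 0) (J : Finset (Fin 5)) (i : Fin 5) :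
    signChange b J i ≠ 0 := by
  unfold signChange
  split_ifs <;> simp [hb]

theorem signChange_injective (h2 : (2 : K) ≠ 0) {b : Fin 5 → K} (hb : ∀ i, b i ≠ 0) :
    Function.Injective (signChange b) := by
  have key {J J' : Finset (Fin 5)} (h : signChange b J = signChange b J') : J ⊆ J' := by
    intro i hi
    by_contra hi'
    have := congrFun h i
    simp only [signChange, hi, hi', if_true, if_false] at this
    have h0 : 2 * b i = 0 := by linear_combination -this
    exact (mul_ne_zero h2 (hb i)) h0
  exact fun J J' h => (key h).antisymm (key h.symm)

/-- Equal points have proportional coordinates, and the common nonzero sum fixes the scalar at 1. -/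
theorem eq_of_torusPoint_eq {c d : Fin 5 → K} (hc : ∀ i, c i ≠ 0) (hd : ∀ i, d i ≠ 0)
    (hs : ∑ i, c i = ∑ i, d i) (hs0 : ∑ i, d i ≠ 0) (h : torusPoint c = torusPoint d) : c = d := by
  have hr (i : Fin 5) : c i * d 0 = c 0 * d i := by
    rcases eq_or_ne i 0 with rfl | hi
    · rfl
    · have := ratio_torusPoint hc hi
      rw [h, ratio_torusPoint hd hi, Option.some_inj, div_eq_div_iff (hd 0) (hc 0)] at this
      linear_combination -this
  have h0 : c 0 = d 0 := by
    apply mul_right_cancel₀ hs0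
    rw [Finset.mul_sum, Finset.sum_congr rfl fun i _ => (hr i).symm, ← Finset.sum_mul, hs]
    ring
  funext i
  apply mul_right_cancel₀ (hd 0)
  rw [hr, h0, mul_comm]

theorem bijOn_torusNodes (h2 : (2 : K) ≠ 0) {b : Fin 5 → K} (hb : ∀ i, b i ≠ 0)
    (hs : ∑ i, b i ≠ 0) :
    Set.BijOn (fun J : Finset (Fin 5) => torusPoint (signChange b J))
      {J : Finset (Fin 5) | ∑ i ∈ J, b i = 0} (nodes (phi b) ∩ torus K) := by
  have hsum {J : Finset (Fin 5)} (hJ : ∑ i ∈ J, b i = 0) : ∑ i, signChange b J i = ∑ i, b i := by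
    rw [sum_signChange, hJ, mul_zero, sub_zero]
  refine ⟨fun J hJ => ⟨?_, _, signChange_ne_zero hb J, rfl⟩, fun J hJ J' hJ' h => ?_, ?_⟩
  · exact torusPoint_mem_nodes h2 hb hs (signChange_sq b J) (hsum hJ)
  · refine signChange_injective h2 hb (eq_of_torusPoint_eq (signChange_ne_zero hb J)
      (signChange_ne_zero hb J') ((hsum hJ).trans (hsum hJ').symm) ?_ h)
    rwa [hsum hJ']
  · rintro _ ⟨⟨ς, p, rfl, hp⟩, hP⟩
    rcases eq_boundaryCoords_or_of_isAffineNode h2 hb hs hp with rfl | ⟨J, hJ, h⟩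
    · exact absurd hP (boundaryNode_notMem_torus b ς)
    · exact ⟨J, hJ, h.symm⟩

end Count

end A4Toric

end

theorem mainTheorem9 {K : Type*} [Field K] (h2 : (2 : K) ≠ 0) (b : Fin 5 → K)
    (hb : ∀ i, b i ≠ 0) (hs : ∑ i, b i ≠ 0) :
    (A4Toric.nodes (A4Toric.phi b)).encard =
        30 + {J : Finset (Fin 5) | ∑ i ∈ J, b i = 0}.encard ∧
      (A4Toric.nodes (A4Toric.phi b) \ A4Toric.torus K).encard = 30 ∧
      Set.BijOn (fun J : Finset (Fin 5) => A4Toric.torusPoint (A4Toric.signChange b J))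
        {J : Finset (Fin 5) | ∑ i ∈ J, b i = 0}
        (A4Toric.nodes (A4Toric.phi b) ∩ A4Toric.torus K) := by
  have hbij := A4Toric.bijOn_torusNodes h2 hb hs
  have hdiff : (A4Toric.nodes (A4Toric.phi b) \ A4Toric.torus K).encard = 30 := by
    rw [A4Toric.nodes_diff_torus h2 hb hs, A4Toric.encard_range_boundaryNode hb]
  refine ⟨?_, hdiff, hbij⟩
  rw [← Set.encard_sdiff_add_encard_inter (A4Toric.nodes (A4Toric.phi b)) (A4Toric.torus K), hdiff,
    ← hbij.image_eq, hbij.injOn.encard_image]
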